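/- Let $m\ge 2$, let $d_1,\dots,d_m$ be mode sizes, let $r=(r_1,\dots,r_{m-1})$ be positive integers, and put $r_0=r_m=1$. For a tensor $\mathcal T\in\mathbb R^{d_1\times\cdots\times d_m}$ let $\mathcal T^{\langle i\rangle}$ denote its $i$-th separation, that is, the $(d_1\cdots d_i)\times(d_{i+1}\cdots d_m)$ matrix with entries $\mathcal T^{\langle i\rangle}(x_1\cdots x_i,\,x_{i+1}\cdots x_m)=\mathcal T(x_1,\dots,x_m)$, and let $\|\cdot\|_{\rm F}$ be the Frobenius norm. Let $\mathbb M^{\sf tt}_{r}$ be the set of tensors with $\operatorname{rank}\mathcal T^{\langle i\rangle}\le r_i$ for all $1\le i\le m-1$. For $\mathcal T^*\in\mathbb M^{\sf tt}_{r}$ put $\underline\sigma=\min_{1\le i\le m-1}\sigma_{r_i}\big((\mathcal T^*)^{\langle i\rangle}\big)$, where $\sigma_k$ is the $k$-th largest singular value (and $\sigma_k=0$ beyond the rank). The TT-SVD of $\mathcal T$ with target rank $r$ is computed as follows. Set $\widehat T^{\le 0}=[1]$. For $i=1,\dots,m-1$, let $L(\widehat T_i)\in\mathbb R^{r_{i-1}d_i\times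 r_i}$ consist of the top $r_i$ left singular vectors of $(\widehat T^{\le i-1}\otimes I_{d_i})^{\top}\mathcal T^{\langle i\rangle}$, and set $\widehat T^{\le i}=(\widehat T^{\le i-1}\otimes I_{d_i})L(\widehat T_i)$. Finally set $\widehat T_m=(\widehat T^{\le m-1})^{\top}\mathcal T^{\langle m-1\rangle}$. The output ${\sf SVD}^{\sf tt}_r(\mathcal T)$ is the tensor $[\widehat T_1,\dots,\widehat T_m]$ with entries $\widehat T_1(x_1)\cdots\widehat T_m(x_m)$, where $\widehat T_i(x)\in\mathbb R^{r_{i-1}\times r_i}$ is the matrix with entries $\widehat T_i(x)_{j,k}=L(\widehat T_i)_{jx,k}$ for $i\le m-1$, and $\widehat T_m(x)$ is column $x$ of $\widehat T_m$. Singular vectors need not be unique; the statements below hold for every choice of them. **Lemma (perturbation bound for TT-SVD).** Let $\mathcal T^*\in\mathbb M^{\sf tt}_{r}$ and let $C_m\ge 500m$. 1. Let $\mathcal D\in\mathbb R^{d_1\times\cdots\times d_m}$ satisfy $\underline\sigma\ge C_m\|\mathcal D\|_{\rm F}$. Then every output of TT-SVD satisfies $$\big\|{\sf SVD}^{\sf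 tt}_{r}(\mathcal T^*+\mathcal D)-\mathcal T^*\big\|_{\rm F}^2\;\le\;\|\mathcal D\|_{\rm F}^2+\frac{600\,m\,\|\mathcal D\|_{\rm F}^3}{\underline\sigma},$$ and if $\underline\sigma>0$ (that is, if the TT rank of $\mathcal T^*$ is exactly $r$), then TT-SVD can be carried out on $\mathcal T^*+\mathcal D$. (If $\underline\sigma=0$, then $\mathcal D=0$ and the last term is read as $0$.) In particular the bound does not involve the condition number of $\mathcal T^*$. 2. The leading constant $1$ is sharp: if $\underline\sigma>0$, then for every $c<1$ and every $K\in\mathbb R$ there is a $\mathcal D\ne 0$ with $\underline\sigma\ge C_m\|\mathcal D\|_{\rm F}$ such that every output of TT-SVD satisfies $$\big\|{\sf SVD}^{\sf tt}_{r}(\mathcal T^*+\mathcal D)-\mathcal T^*\big\|_{\rm F}^2\;>\;c\,\|\mathcal D\|_{\rm F}^2+\frac{K\,\|\mathcal D\|_{\rm F}^3}{\underline\sigma}.$$ -/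

import Mathlib

open scoped Matrix Kronecker

noncomputable section

namespace TensorTrain

/-! Indices are shifted by one: the mode sizes `d₁, …, d_m` of an order-`m` tensor are the values
`d 0, …, d (m - 1)`; the ranks `r₀ = 1, r₁, …, r_{m-1}, r_m = 1` are the values `r 0, …, r m`.
All other values of `d` and `r` are irrelevant. -/

/-- Multi-indices `(x₁, …, x_k)` in `[d₁] × ⋯ × [d_k]`. -/
abbrev Pre (d : ℕ → ℕ) (k : ℕ) : Type := (j : Fin k) → Fin (d j)

/-- Multi-indices `(x_{k+1}, …, x_m)` in `[d_{k+1}] × ⋯ × [d_m]`. -/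
abbrev Suf (d : ℕ → ℕ) (m k : ℕ) : Type := (j : {j : Fin m // k ≤ (j : ℕ)}) → Fin (d (j : Fin m))

/-- Real tensors of size `d₁ × ⋯ × d_m`. -/
abbrev Tensor (d : ℕ → ℕ) (m : ℕ) : Type := Pre d m → ℝ

/-- The multi-index `(x₁, …, x_k, y_{k+1}, …, y_m)`. -/
def glue {d : ℕ → ℕ} {m k : ℕ} (x : Pre d k) (y : Suf d m k) : Pre d m :=
  fun j => if h : (j : ℕ) < k then x ⟨j, h⟩ else y ⟨j, not_lt.mp h⟩

/-- The Frobenius norm of a tensor. -/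
def fro {d : ℕ → ℕ} {m : ℕ} (T : Tensor d m) : ℝ := √(∑ x, T x ^ 2)

/-- The `k`-th separation `T^⟨k⟩`, a `(d₁ ⋯ d_k) × (d_{k+1} ⋯ d_m)` matrix. -/
def sep {d : ℕ → ℕ} {m : ℕ} (T : Tensor d m) (k : ℕ) : Matrix (Pre d k) (Suf d m k) ℝ :=
  Matrix.of fun x y => T (glue x y)

/-- The tensors of TT rank at most `(r₁, …, r_{m-1})`. -/
def ttSet (d : ℕ → ℕ) (m : ℕ) (r : ℕ → ℕ) : Set (Tensor d m) :=
  {T | ∀ k, 1 ≤ k → k < m → (sep T k).rank ≤ r k}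

/-- The `k`-th largest singular value of a matrix, `k ≥ 1` (Mathlib counts from zero). -/
def singVal {p q : Type} [Fintype p] [Fintype q] [DecidableEq q] (A : Matrix p q ℝ) (k : ℕ) : ℝ :=
  (Matrix.toEuclideanLin A).singularValues (k - 1)

/-- The signal strength `min_{1 ≤ i ≤ m-1} σ_{r_i}(T^⟨i⟩)`. -/
def sigmaMin {d : ℕ → ℕ} {m : ℕ} (r : ℕ → ℕ) (T : Tensor d m) : ℝ :=
  ⨅ i : Fin (m - 1), singVal (sep T (i + 1)) (r (i + 1))

/-- The columns `u₁, …, u_s` of `U` are top `s` left singular vectors of `A`: they are orthonormal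
and `u_j` is an eigenvector of `A Aᵀ` for its `j`-th largest eigenvalue `σ_j(A)²` (eigenvalues
counted with multiplicity). -/
def IsTopLeftSingularVectors {p q : Type} [Fintype p] [Fintype q] [DecidableEq q]
    {s : ℕ} (A : Matrix p q ℝ) (U : Matrix p (Fin s) ℝ) : Prop :=
  Uᵀ * U = 1 ∧ ∀ j : Fin s, (A * Aᵀ) *ᵥ U.col j = singVal A (j + 1) ^ 2 • U.col j

/-- A sequence of TT components: `G k x` is the `r_k × r_{k+1}` matrix `T_{k+1}(x)`. -/
abbrev Components (d r : ℕ → ℕ) : Type :=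
  (k : ℕ) → Fin (d k) → Matrix (Fin (r k)) (Fin (r (k + 1))) ℝ

/-- The left unfolding `L(U)(jx, k) = U(j, x, k)` of a three-way tensor. -/
def leftUnfold {p₁ p₂ p₃ : ℕ} (U : Fin p₂ → Matrix (Fin p₁) (Fin p₃) ℝ) :
    Matrix (Fin p₁ × Fin p₂) (Fin p₃) ℝ :=
  Matrix.of fun jx k => U jx.2 jx.1 k

/-- The left parts: row `(x₁, …, x_k)` of `leftPart G k` is `T₁(x₁) T₂(x₂) ⋯ T_k(x_k)`, and
`leftPart G 0 = [1]`. -/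
def leftPart {d r : ℕ → ℕ} (G : Components d r) : (k : ℕ) → Matrix (Pre d k) (Fin (r k)) ℝ
  | 0 => Matrix.of fun _ _ => 1
  | k + 1 => Matrix.of fun x =>
      (leftPart G k (fun j : Fin k => x j.castSucc)) ᵥ* (G k (x (Fin.last k)))

/-- The tensor `[T₁, …, T_m]` with entries `T₁(x₁) ⋯ T_m(x_m)`. As `r_m = 1`, this product is a
`1 × 1` matrix and the sum below has exactly one term. -/
def ofComponents {d r : ℕ → ℕ} (m : ℕ) (G : Components d r) : Tensor d m :=
  fun x => ∑ b : Fin (r m), leftPart G m x b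

/-- The Kronecker product `M ⊗ I_{d_{k+1}}`, a row `((x₁, …, x_k), x_{k+1})` being identified with
`(x₁, …, x_{k+1})`. -/
def kronId {d : ℕ → ℕ} {k s : ℕ} (M : Matrix (Pre d k) (Fin s) ℝ) :
    Matrix (Pre d (k + 1)) (Fin s × Fin (d k)) ℝ :=
  (M ⊗ₖ (1 : Matrix (Fin (d k)) (Fin (d k)) ℝ)).submatrix
    (fun x => (fun j : Fin k => x j.castSucc, x (Fin.last k))) id

/-- `S` is an output of the TT-SVD algorithm with input `T` and target rank `r`, for some choice of
the singular vectors at each step: for `i = 1, …, m-1`, the matrix `L(T_i)` consists of top `r_i`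
left singular vectors of `(T^{≤ i-1} ⊗ I)ᵀ T^⟨i⟩`; then `T_m = (T^{≤ m-1})ᵀ T^⟨m-1⟩`; the output
is `[T₁, …, T_m]`. -/
def IsTTSVD {d : ℕ → ℕ} {m : ℕ} (r : ℕ → ℕ) (T S : Tensor d m) : Prop :=
  ∃ G : Components d r,
    (∀ k, k + 1 < m →
      IsTopLeftSingularVectors ((kronId (leftPart G k))ᵀ * sep T (k + 1)) (leftUnfold (G k))) ∧
    (∀ k, ∀ hk : k + 1 = m, ∀ (y : Suf d m k) (a : Fin (r k)) (b : Fin (r (k + 1))),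
      G k (y ⟨⟨k, by omega⟩, le_rfl⟩) a b = ((leftPart G k)ᵀ * sep T k) a y) ∧
    S = ofComponents m G

end TensorTrain

end

/-! Let `X` be the last left part; its columns are orthonormal. The output is the orthogonal
projection of `T + D` onto the range of `X`, so by Pythagoras the squared error is `‖Xᵀ D‖²` plus
the energy of `T` outside that range, that is `fro D ^ 2 - lostEnergy G D n + lostEnergy G T n`. It
remains to show that the signal loses hardly more energy than the noise. Lost energy is additive
over the steps (`lostEnergy_succ`). In one step, let `M` and `E` be the compressed signal and noise,
`U` the singular vectors, `R` the residual of `M + E`, and `V` the projection onto a row space of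
`M`. Then `M - U Uᵀ M = R V - (E - U Uᵀ E) V`, and `R Mᵀ = R Rᵀ - R Eᵀ` is quadratic in the noise.
As `M` has singular values at least `σ / 2` on the range of `V`, `‖R V‖` is of order `ε² / σ`.
Squaring gives an excess of order `ε³ / σ` per step, with no condition number. The bound on `M`
persists because the signal has lost little so far (`exists_projection_compressed`); the two facts
are proved by one induction in `IsPartialRun.lostEnergy_le`. The same bound keeps the ranks large
enough for the algorithm to run. For sharpness, `D` is a small multiple of the signal: `T + D` keeps
its ranks, TT-SVD reproduces it, and the error is exactly `D`. -/

noncomputable section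

namespace TensorTrain

open Matrix

attribute [local instance] Matrix.frobeniusNormedAddCommGroup Matrix.frobeniusNormedSpace

/-! ### Frobenius norm and orthogonal projections. -/

section FrobeniusNorm

variable {l p q : Type*} [Fintype l] [Fintype p] [Fintype q]

theorem norm_sq_eq_sum (A : Matrix p q ℝ) : ‖A‖ ^ 2 = ∑ i, ∑ j, A i j ^ 2 := by
  have h : 0 ≤ ∑ i, ∑ j, ‖A i j‖ ^ (2 : ℝ) := by positivity
  rw [Matrix.frobenius_norm_def, ← Real.sqrt_eq_rpow, Real.sq_sqrt h]
  simp

theorem norm_sq_eq_trace (A : Matrix p q ℝ) : ‖A‖ ^ 2 = (Aᵀ * A).trace := by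
  rw [norm_sq_eq_sum, Finset.sum_comm]
  simp [Matrix.trace, Matrix.mul_apply, sq]

theorem norm_sq_eq_trace' (A : Matrix p q ℝ) : ‖A‖ ^ 2 = (A * Aᵀ).trace := by
  rw [norm_sq_eq_trace, Matrix.trace_mul_comm]

/-- Pythagoras for the orthogonal projection onto the column space of a matrix with orthonormal
columns. -/
theorem norm_sq_sub_mul_transpose_mul [DecidableEq l] {U : Matrix p l ℝ} (hU : Uᵀ * U = 1)
    (A : Matrix p q ℝ) : ‖A - U * (Uᵀ * A)‖ ^ 2 = ‖A‖ ^ 2 - ‖Uᵀ * A‖ ^ 2 := by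
  simp only [norm_sq_eq_trace, ← Matrix.trace_sub]
  congr 1
  have h : Aᵀ * U * Uᵀ * U * (Uᵀ * A) = Aᵀ * U * (Uᵀ * A) := by
    rw [Matrix.mul_assoc (Aᵀ * U), hU, Matrix.mul_one]
  simp only [Matrix.transpose_sub, Matrix.transpose_mul, Matrix.transpose_transpose,
    Matrix.sub_mul, Matrix.mul_sub, ← Matrix.mul_assoc] at h ⊢
  rw [h]
  abel

theorem norm_transpose_mul_le [DecidableEq l] {U : Matrix p l ℝ} (hU : Uᵀ * U = 1)
    (A : Matrix p q ℝ) : ‖Uᵀ * A‖ ≤ ‖A‖ := by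
  have h := norm_sq_sub_mul_transpose_mul hU A
  have h' := sq_nonneg ‖A - U * (Uᵀ * A)‖
  exact le_of_sq_le_sq (by linarith) (norm_nonneg _)

theorem norm_mul_of_transpose_mul_self [DecidableEq l] {U : Matrix p l ℝ} (hU : Uᵀ * U = 1)
    (A : Matrix l q ℝ) : ‖U * A‖ = ‖A‖ := by
  have h : ‖U * A‖ ^ 2 = ‖A‖ ^ 2 := by
    rw [norm_sq_eq_trace, norm_sq_eq_trace, Matrix.transpose_mul, Matrix.mul_assoc,
      ← Matrix.mul_assoc Uᵀ, hU, Matrix.one_mul]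
  exact (sq_eq_sq₀ (norm_nonneg _) (norm_nonneg _)).mp h

/-- Pythagoras for multiplication by an orthogonal projection from the right. -/
theorem norm_sq_sub_mul_projection {V : Matrix q q ℝ} (hVt : Vᵀ = V) (hV : V * V = V)
    (A : Matrix p q ℝ) : ‖A - A * V‖ ^ 2 = ‖A‖ ^ 2 - ‖A * V‖ ^ 2 := by
  simp only [norm_sq_eq_trace', ← Matrix.trace_sub]
  congr 1
  have h : A * V * V = A * V := by rw [Matrix.mul_assoc, hV]
  simp only [Matrix.transpose_sub, Matrix.transpose_mul, hVt, Matrix.sub_mul, Matrix.mul_sub,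
    ← Matrix.mul_assoc, h]
  abel

theorem norm_mul_projection_le {V : Matrix q q ℝ} (hVt : Vᵀ = V) (hV : V * V = V)
    (A : Matrix p q ℝ) : ‖A * V‖ ≤ ‖A‖ := by
  have h := norm_sq_sub_mul_projection hVt hV A
  have h' := sq_nonneg ‖A - A * V‖
  exact le_of_sq_le_sq (by linarith) (norm_nonneg _)

end FrobeniusNorm

/-! ### Singular values and right singular bases. -/

section SingularValues

variable {p q : Type} [Fintype p] [Fintype q] [DecidableEq q]

theorem singVal_nonneg (A : Matrix p q ℝ) (k : ℕ) : 0 ≤ singVal A k :=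
  LinearMap.singularValues_nonneg _ _

theorem singVal_succ_antitone (A : Matrix p q ℝ) : Antitone fun k => singVal A (k + 1) :=
  fun i j h => by simpa [singVal] using LinearMap.singularValues_antitone _ h

theorem rank_eq_finrank_range_toEuclideanLin (A : Matrix p q ℝ) :
    A.rank = Module.finrank ℝ (Matrix.toEuclideanLin A).range := by
  classical
  change _ = Module.finrank ℝ (Matrix.toLpLin 2 2 A).range
  rw [Matrix.toLpLin_eq_toLin]
  exact Matrix.rank_eq_finrank_range_toLin A _ _

theorem singVal_succ_pos_iff (A : Matrix p q ℝ) (k : ℕ) : 0 < singVal A (k + 1) ↔ k < A.rank := by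
  rw [rank_eq_finrank_range_toEuclideanLin, ← LinearMap.singularValues_pos_iff_lt_finrank_range]
  simp [singVal]

theorem singVal_succ_eq_zero (A : Matrix p q ℝ) {k : ℕ} (h : A.rank ≤ k) :
    singVal A (k + 1) = 0 :=
  le_antisymm (not_lt.mp fun h' => absurd ((singVal_succ_pos_iff A k).mp h') (by omega))
    (singVal_nonneg A _)

/-- A complete system of right singular vectors, sorted by singular value. -/
theorem exists_rightSingularBasis (A : Matrix p q ℝ) :
    ∃ W : Matrix q (Fin (Fintype.card q)) ℝ, Wᵀ * W = 1 ∧ W * Wᵀ = 1 ∧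
      Aᵀ * A * W = W * Matrix.diagonal fun j : Fin (Fintype.card q) => singVal A (j + 1) ^ 2 := by
  classical
  have hn : Module.finrank ℝ (EuclideanSpace ℝ q) = Fintype.card q := by simp
  obtain ⟨b, hb⟩ : ∃ b : OrthonormalBasis (Fin (Fintype.card q)) ℝ (EuclideanSpace ℝ q), ∀ j,
      Matrix.toEuclideanLin Aᴴ (Matrix.toEuclideanLin A (b j))
        = (singVal A (j + 1) ^ 2) • b j := by
    refine ⟨(Matrix.toEuclideanLin A).isSymmetric_adjoint_comp_self.eigenvectorBasis hn,
      fun j => ?_⟩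
    have h := (Matrix.toEuclideanLin A).isSymmetric_adjoint_comp_self.apply_eigenvectorBasis hn j
    rw [← LinearMap.sq_singularValues_fin] at h
    rw [Matrix.toEuclideanLin_conjTranspose_eq_adjoint]
    exact h
  obtain ⟨W, hW⟩ : ∃ W : Matrix q (Fin (Fintype.card q)) ℝ, ∀ i j, W i j = b j i :=
    ⟨Matrix.of fun i j => b j i, fun _ _ => rfl⟩
  have h₁ : Wᵀ * W = 1 := by
    ext i j
    have := orthonormal_iff_ite.mp b.orthonormal i j
    rw [Matrix.one_apply, ← this, PiLp.inner_apply]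
    simp [hW, Matrix.mul_apply, mul_comm]
  have h₂ : W * Wᵀ = 1 :=
    (Matrix.mul_eq_one_comm_of_card_eq _ _ _ (by simp)).mp h₁
  refine ⟨W, h₁, h₂, ?_⟩
  ext i j
  have h' := congrArg (fun v => v.ofLp i) (hb j)
  simp only [Matrix.toLpLin_apply, Matrix.mulVec_mulVec,
    Matrix.conjTranspose_eq_transpose_of_trivial] at h'
  rw [Matrix.mul_diagonal, mul_comm (W i j), hW, Matrix.mul_apply]
  simp only [hW]
  exact h'

end SingularValues

/-! ### Projections onto leading singular spaces. -/

section Perturbation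

variable {p q : Type} [Fintype p] [Fintype q] [DecidableEq q]

/-- A weighted sum of a decreasing sequence with weights in `[0, 1]` of total mass at most `r` is at
most the sum of its first `r` terms. -/
theorem sum_mul_le_sum_range {n r : ℕ} {a : ℕ → ℝ} (ha : Antitone a) (ha₀ : ∀ j, 0 ≤ a j)
    {w : Fin n → ℝ} (hw₀ : ∀ j, 0 ≤ w j) (hw₁ : ∀ j, w j ≤ 1) (hw : ∑ j, w j ≤ r) :
    ∑ j : Fin n, a j * w j ≤ ∑ j ∈ Finset.range r, a j := by
  -- Compare with the threshold `a r`: the excess `a j - a r` is nonnegative before `r`, where the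
  -- weight is at most 1, and nonpositive from `r` on.
  have h₁ : ∀ j : Fin n, a j * w j ≤ a r * w j + if (j : ℕ) < r then a j - a r else 0 := by
    intro j
    split_ifs with h
    · nlinarith [ha h.le, hw₁ j]
    · nlinarith [ha (not_lt.mp h), hw₀ j]
  have h₂ : ∑ j : Fin n, (if (j : ℕ) < r then a j - a r else 0)
      ≤ ∑ j ∈ Finset.range r, (a j - a r) := by
    rw [Fin.sum_univ_eq_sum_range (fun j => if j < r then a j - a r else 0) n,
      ← Finset.sum_filter]
    refine Finset.sum_le_sum_of_subset_of_nonneg (fun j hj => ?_) fun j hj _ => ?_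
    · simp_all
    · exact sub_nonneg.mpr (ha (Finset.mem_range.mp hj).le)
  calc ∑ j : Fin n, a j * w j
      ≤ ∑ j : Fin n, (a r * w j + if (j : ℕ) < r then a j - a r else 0) :=
        Finset.sum_le_sum fun j _ => h₁ j
    _ = a r * ∑ j, w j + ∑ j : Fin n, (if (j : ℕ) < r then a j - a r else 0) := by
        rw [Finset.sum_add_distrib, Finset.mul_sum]
    _ ≤ a r * r + ∑ j ∈ Finset.range r, (a j - a r) :=
        add_le_add (mul_le_mul_of_nonneg_left hw (ha₀ r)) h₂
    _ = ∑ j ∈ Finset.range r, a j := by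
        simp [Finset.sum_sub_distrib, mul_comm]

theorem trace_mul_diagonal_mul_transpose {l n : Type*} [Fintype l] [Fintype n] [DecidableEq n]
    (B : Matrix l n ℝ) (c : n → ℝ) :
    (B * Matrix.diagonal c * Bᵀ).trace = ∑ j, c j * ∑ i, B i j ^ 2 := by
  simp only [Matrix.trace, Matrix.diag, Matrix.mul_apply (M := B * Matrix.diagonal c),
    Matrix.mul_diagonal, Matrix.transpose_apply]
  rw [Finset.sum_comm]
  refine Finset.sum_congr rfl fun j _ => ?_
  rw [Finset.mul_sum]
  exact Finset.sum_congr rfl fun i _ => by ring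

/-- The projection onto the span of the leading right singular vectors of a matrix of rank at most
`r`. -/
theorem exists_rowProjection (A : Matrix p q ℝ) {r : ℕ} (hr : 0 < r) (hA : A.rank ≤ r) :
    ∃ V : Matrix q q ℝ, Vᵀ = V ∧ V * V = V ∧ V.trace ≤ r ∧ A * V = A ∧
      ∀ {l : Type} [Fintype l] (R : Matrix l q ℝ),
        singVal A r ^ 2 * ‖R * V‖ ^ 2 ≤ ‖R * Aᵀ‖ ^ 2 := by
  obtain ⟨W, h₁, h₂, h₃⟩ := exists_rightSingularBasis A
  let c : Fin (Fintype.card q) → ℝ := fun j => if (j : ℕ) < r then 1 else 0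
  have hcc : (fun j => c j * c j) = c := by ext j; simp [c]
  have hVt : (W * Matrix.diagonal c * Wᵀ)ᵀ = W * Matrix.diagonal c * Wᵀ := by
    simp [Matrix.transpose_mul, Matrix.mul_assoc]
  have hV : W * Matrix.diagonal c * Wᵀ * (W * Matrix.diagonal c * Wᵀ)
      = W * Matrix.diagonal c * Wᵀ := by
    rw [Matrix.mul_assoc (W * Matrix.diagonal c), ← Matrix.mul_assoc Wᵀ, ← Matrix.mul_assoc Wᵀ, h₁,
      Matrix.one_mul, ← Matrix.mul_assoc, Matrix.mul_assoc W, Matrix.diagonal_mul_diagonal, hcc]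
  -- The trace is `min r (card q)`, hence only an inequality in terms of `r`.
  refine ⟨W * Matrix.diagonal c * Wᵀ, hVt, hV, ?_, ?_, ?_⟩
  · rw [Matrix.trace_mul_comm, ← Matrix.mul_assoc, h₁, Matrix.one_mul, Matrix.trace_diagonal,
      Fin.sum_univ_eq_sum_range (fun j => if j < r then (1 : ℝ) else 0), ← Finset.sum_filter,
      Finset.sum_const, nsmul_eq_mul, mul_one]
    have : (Finset.range (Fintype.card q)).filter (· < r) ⊆ Finset.range r := fun j hj => by
      simp_all
    simpa using Finset.card_le_card this
  · have h₄ : Aᵀ * (A * (W * Matrix.diagonal fun j => 1 - c j)) = 0 := by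
      rw [← Matrix.mul_assoc, ← Matrix.mul_assoc, h₃, Matrix.mul_assoc,
        Matrix.diagonal_mul_diagonal]
      convert Matrix.mul_zero W
      ext i j
      rw [Matrix.diagonal_apply]
      split_ifs with hij
      · by_cases hi : (i : ℕ) < r
        · simp [c, hi]
        · simp [c, hi, singVal_succ_eq_zero A (hA.trans (not_lt.mp hi))]
      · rfl
    have h₅ : A * (W * Matrix.diagonal fun j => 1 - c j) = 0 := by
      have h := Matrix.conjTranspose_mul_self_mul_eq_zero A (W * Matrix.diagonal fun j => 1 - c j)
      rw [Matrix.conjTranspose_eq_transpose_of_trivial, Matrix.mul_assoc] at h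
      exact h.mp h₄
    have h₆ : (Matrix.diagonal fun j => 1 - c j) = 1 - Matrix.diagonal c := by
      rw [← Matrix.diagonal_one, Matrix.diagonal_sub]
    rw [h₆, Matrix.mul_sub, Matrix.mul_sub, Matrix.mul_one, sub_eq_zero] at h₅
    rw [← Matrix.mul_assoc, ← h₅, Matrix.mul_assoc, h₂, Matrix.mul_one]
  · intro l _ R
    have e₁ : R * Aᵀ * (R * Aᵀ)ᵀ
        = R * W * (Matrix.diagonal fun j : Fin (Fintype.card q) => singVal A (j + 1) ^ 2)
          * (R * W)ᵀ := by
      have h : Aᵀ * A = W * (Matrix.diagonal fun j : Fin (Fintype.card q) =>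
          singVal A (j + 1) ^ 2) * Wᵀ := by
        rw [← h₃, Matrix.mul_assoc, h₂, Matrix.mul_one]
      rw [Matrix.transpose_mul, Matrix.transpose_transpose, Matrix.transpose_mul,
        Matrix.mul_assoc R, ← Matrix.mul_assoc Aᵀ, h]
      simp only [Matrix.mul_assoc]
    have e₂ : R * (W * Matrix.diagonal c * Wᵀ) * (R * (W * Matrix.diagonal c * Wᵀ))ᵀ
        = R * W * Matrix.diagonal c * (R * W)ᵀ := by
      rw [Matrix.transpose_mul, hVt, Matrix.mul_assoc R, ← Matrix.mul_assoc _ _ Rᵀ, hV,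
        Matrix.transpose_mul]
      simp only [Matrix.mul_assoc]
    rw [norm_sq_eq_trace', norm_sq_eq_trace', e₁, e₂, trace_mul_diagonal_mul_transpose,
      trace_mul_diagonal_mul_transpose, Finset.mul_sum]
    refine Finset.sum_le_sum fun j _ => ?_
    rw [← mul_assoc]
    refine mul_le_mul_of_nonneg_right ?_ (Finset.sum_nonneg fun i _ => sq_nonneg _)
    by_cases hj : (j : ℕ) < r
    · have h := singVal_succ_antitone A (show (j : ℕ) ≤ r - 1 by omega)
      simp only [Nat.sub_add_cancel hr] at h
      simpa [c, hj] using pow_le_pow_left₀ (singVal_nonneg A r) h 2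
    · simp [c, hj, sq_nonneg]

/-- Ky Fan's principle: in a right singular basis `W` the left side is a sum of squared singular
values with weights `(Wᵀ V W) j j`, which lie in `[0, 1]` and add up to the trace of `V`. -/
theorem norm_sq_mul_projection_le (N : Matrix p q ℝ) {r : ℕ} {V : Matrix q q ℝ} (hVt : Vᵀ = V)
    (hV : V * V = V) (htr : V.trace ≤ r) :
    ‖N * V‖ ^ 2 ≤ ∑ j ∈ Finset.range r, singVal N (j + 1) ^ 2 := by
  obtain ⟨W, h₁, h₂, h₃⟩ := exists_rightSingularBasis N
  have hN : Nᵀ * N = W * (Matrix.diagonal fun j : Fin (Fintype.card q) =>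
      singVal N (j + 1) ^ 2) * Wᵀ := by
    rw [← h₃, Matrix.mul_assoc, h₂, Matrix.mul_one]
  have e : ‖N * V‖ ^ 2
      = ∑ j : Fin (Fintype.card q), singVal N (j + 1) ^ 2 * ∑ i, (V * W) i j ^ 2 := by
    rw [norm_sq_eq_trace, ← trace_mul_diagonal_mul_transpose, Matrix.transpose_mul,
      Matrix.mul_assoc, ← Matrix.mul_assoc Nᵀ, hN, Matrix.transpose_mul, hVt]
    simp only [Matrix.mul_assoc]
  have hw : ∀ (B : Matrix q q ℝ) (j : Fin (Fintype.card q)),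
      ∑ i, (B * W) i j ^ 2 = (Wᵀ * (Bᵀ * B) * W) j j := by
    intro B j
    rw [← Matrix.mul_assoc, Matrix.mul_assoc _ B, ← Matrix.transpose_mul, Matrix.mul_apply]
    simp [sq]
  rw [e]
  refine sum_mul_le_sum_range (a := fun j => singVal N (j + 1) ^ 2) (fun i j hij => ?_)
    (fun j => sq_nonneg _) (fun j => Finset.sum_nonneg fun i _ => sq_nonneg _) (fun j => ?_) ?_
  · exact pow_le_pow_left₀ (singVal_nonneg N _) (singVal_succ_antitone N hij) 2
  · have h := hw (1 - V) j
    -- The complement `1 - V` is a projection too; its nonnegative weights show that those of `V`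
    -- are at most 1.
    have h' : (1 - V)ᵀ * (1 - V) = 1 - V := by
      simp [hVt, Matrix.mul_sub, Matrix.sub_mul, hV]
    have h₀ : 0 ≤ ∑ i, ((1 - V) * W : Matrix q _ ℝ) i j ^ 2 := Finset.sum_nonneg fun i _ => sq_nonneg _
    rw [hw, hVt, hV]
    rw [h, h', Matrix.mul_sub, Matrix.sub_mul, Matrix.mul_one, h₁, Matrix.sub_apply,
      Matrix.one_apply_eq] at h₀
    linarith
  · simp only [hw, hVt, hV]
    refine le_of_eq_of_le ?_ htr
    change (Wᵀ * V * W).trace = _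
    rw [Matrix.trace_mul_comm, ← Matrix.mul_assoc, h₂, Matrix.one_mul]

/-! ### Truncation to top left singular vectors. -/

variable {s : ℕ} {U : Matrix p (Fin s) ℝ}

theorem IsTopLeftSingularVectors.mul_transpose_mul {N : Matrix p q ℝ}
    (hU : IsTopLeftSingularVectors N U) :
    N * Nᵀ * U = U * Matrix.diagonal fun j : Fin s => singVal N (j + 1) ^ 2 := by
  ext i j
  have h := congrFun (hU.2 j) i
  rw [Matrix.mul_diagonal, mul_comm (U i j)]
  simpa [Matrix.mulVec, dotProduct, Matrix.mul_apply (M := N * Nᵀ)] using h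

theorem IsTopLeftSingularVectors.norm_sq {N : Matrix p q ℝ}
    (hU : IsTopLeftSingularVectors N U) :
    ‖Uᵀ * N‖ ^ 2 = ∑ j ∈ Finset.range s, singVal N (j + 1) ^ 2 := by
  rw [norm_sq_eq_trace', Matrix.transpose_mul, Matrix.transpose_transpose, Matrix.mul_assoc,
    ← Matrix.mul_assoc N, hU.mul_transpose_mul, ← Matrix.mul_assoc, hU.1, Matrix.one_mul,
    Matrix.trace_diagonal, Fin.sum_univ_eq_sum_range (fun j => singVal N (j + 1) ^ 2)]

/-- Eckart–Young: the truncation to the top singular vectors is a best low-rank approximation. -/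
theorem IsTopLeftSingularVectors.norm_sub_le {N M : Matrix p q ℝ}
    (hU : IsTopLeftSingularVectors N U) {V : Matrix q q ℝ} (hVt : Vᵀ = V) (hV : V * V = V)
    (htr : V.trace ≤ s) (hM : M * V = M) : ‖N - U * (Uᵀ * N)‖ ≤ ‖N - M‖ := by
  refine le_of_sq_le_sq ?_ (norm_nonneg _)
  have h₁ := norm_sq_sub_mul_transpose_mul hU.1 N
  have h₂ := norm_sq_sub_mul_projection hVt hV (N - M)
  have h₃ := norm_sq_sub_mul_projection hVt hV N
  have h₄ : N - M - (N - M) * V = N - N * V := by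
    rw [Matrix.sub_mul, hM]
    abel
  rw [h₄] at h₂
  have h₅ := norm_sq_mul_projection_le N hVt hV htr
  rw [← hU.norm_sq] at h₅
  linarith [sq_nonneg ‖(N - M) * V‖]

/-- One truncation step: the part of `M` that is lost exceeds the part of the noise `E` that is
removed by a second-order term only. -/
theorem IsTopLeftSingularVectors.norm_sub_le_norm_sub_add {M E : Matrix p q ℝ}
    (hU : IsTopLeftSingularVectors (M + E) U) {V : Matrix q q ℝ} (hVt : Vᵀ = V) (hV : V * V = V)
    (htr : V.trace ≤ s) (hM : M * V = M) {t ε : ℝ}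
    (ht : ∀ R : Matrix p q ℝ, t * ‖R * V‖ ≤ ‖R * Mᵀ‖) (hE : ‖E‖ ≤ ε) :
    ∃ δ, 0 ≤ δ ∧ δ ≤ ε ∧ t * δ ≤ 2 * ε ^ 2 ∧
      ‖M - U * (Uᵀ * M)‖ ≤ ‖E - U * (Uᵀ * E)‖ + δ := by
  obtain ⟨R, hR⟩ : ∃ R, R = M + E - U * (Uᵀ * (M + E)) := ⟨_, rfl⟩
  have hε : 0 ≤ ε := (norm_nonneg E).trans hE
  have hRE : ‖R‖ ≤ ε := by
    have h := hU.norm_sub_le hVt hV htr hM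
    rw [← hR, add_sub_cancel_left] at h
    exact h.trans hE
  -- The range of `U` is invariant under `N Nᵀ` for `N = M + E`, and `R = (1 - U Uᵀ) N`.
  have h₀ : R * (M + E)ᵀ * U = 0 := by
    rw [Matrix.mul_assoc, hR, Matrix.sub_mul, ← Matrix.mul_assoc, Matrix.mul_assoc U,
      Matrix.mul_assoc Uᵀ, ← Matrix.mul_assoc (M + E), hU.mul_transpose_mul, ← Matrix.mul_assoc Uᵀ,
      hU.1, Matrix.one_mul, sub_self]
  have h₁ : R * Rᵀ = R * (M + E)ᵀ := by
    conv_lhs => rw [hR, Matrix.transpose_sub, ← hR, Matrix.transpose_mul, Matrix.transpose_mul,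
      Matrix.transpose_transpose, Matrix.mul_sub, ← Matrix.mul_assoc R, ← Matrix.mul_assoc R, h₀,
      Matrix.zero_mul, sub_zero]
  have h₂ : R * Mᵀ = R * Rᵀ - R * Eᵀ := by
    rw [h₁, Matrix.transpose_add, Matrix.mul_add, add_sub_cancel_right]
  have h₃ : ‖R * Mᵀ‖ ≤ 2 * ε ^ 2 := by
    have a₁ : ‖R * Rᵀ‖ ≤ ε * ε := (Matrix.frobenius_norm_mul R Rᵀ).trans (by
      rw [Matrix.frobenius_norm_transpose]
      exact mul_le_mul hRE hRE (norm_nonneg _) hε)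
    have a₂ : ‖R * Eᵀ‖ ≤ ε * ε := (Matrix.frobenius_norm_mul R Eᵀ).trans (by
      rw [Matrix.frobenius_norm_transpose]
      exact mul_le_mul hRE hE (norm_nonneg _) hε)
    rw [h₂]
    linarith [_root_.norm_sub_le (R * Rᵀ) (R * Eᵀ), sq ε]
  refine ⟨‖R * V‖, norm_nonneg _, (norm_mul_projection_le hVt hV R).trans hRE, (ht R).trans h₃, ?_⟩
  -- Since `M V = M`, the lost signal is seen entirely through `V`, where `R` is of second order.
  have h₄ : M - U * (Uᵀ * M) = R * V - (E - U * (Uᵀ * E)) * V := by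
    have h : M - U * (Uᵀ * M) = (M - U * (Uᵀ * M)) * V := by
      rw [Matrix.sub_mul, Matrix.mul_assoc U, Matrix.mul_assoc Uᵀ, hM]
    rw [h, ← Matrix.sub_mul, hR, Matrix.mul_add, Matrix.mul_add]
    congr 1
    abel
  rw [h₄]
  linarith [_root_.norm_sub_le (R * V) ((E - U * (Uᵀ * E)) * V),
    norm_mul_projection_le hVt hV (E - U * (Uᵀ * E))]

/-! ### Stability of conditioning and rank. -/

omit [DecidableEq q] in
/-- Compression by `Lᵀ` keeps the smallest singular value of `A`, up to the part that is lost. -/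
theorem mul_norm_mul_projection_le {l k : Type} [Fintype l] [DecidableEq l] [Fintype k]
    {A : Matrix p q ℝ} {L : Matrix p l ℝ} (hL : Lᵀ * L = 1) {V : Matrix q q ℝ} (hVt : Vᵀ = V)
    (hAV : A * V = A) {σ t : ℝ} (R : Matrix k q ℝ)
    (hσ : σ ^ 2 * ‖R * V‖ ^ 2 ≤ ‖R * Aᵀ‖ ^ 2)
    (hts : t ^ 2 ≤ σ ^ 2 - (‖A‖ ^ 2 - ‖Lᵀ * A‖ ^ 2)) :
    t * ‖R * V‖ ≤ ‖R * (Lᵀ * A)ᵀ‖ := by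
  refine le_of_sq_le_sq ?_ (norm_nonneg _)
  have h₁ : ‖R * (Lᵀ * A)ᵀ‖ = ‖Lᵀ * (A * Rᵀ)‖ := by
    rw [← Matrix.frobenius_norm_transpose]
    simp [Matrix.transpose_mul, Matrix.mul_assoc]
  have h₂ : ‖R * Aᵀ‖ = ‖A * Rᵀ‖ := by
    rw [← Matrix.frobenius_norm_transpose]
    simp [Matrix.transpose_mul]
  have h₃ := norm_sq_sub_mul_transpose_mul hL (A * Rᵀ)
  have h₄ : A * Rᵀ - L * (Lᵀ * (A * Rᵀ)) = (A - L * (Lᵀ * A)) * (R * V)ᵀ := by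
    rw [Matrix.transpose_mul, hVt, Matrix.sub_mul, Matrix.mul_assoc L, Matrix.mul_assoc Lᵀ,
      ← Matrix.mul_assoc A, hAV]
  -- The Frobenius norm of the lost part of `A` serves as a bound for its operator norm.
  have h₅ : ‖A * Rᵀ - L * (Lᵀ * (A * Rᵀ))‖ ^ 2
      ≤ ‖A - L * (Lᵀ * A)‖ ^ 2 * ‖R * V‖ ^ 2 := by
    rw [h₄, ← mul_pow, ← Matrix.frobenius_norm_transpose (R * V)]
    exact pow_le_pow_left₀ (norm_nonneg _) (Matrix.frobenius_norm_mul _ _) 2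
  rw [norm_sq_sub_mul_transpose_mul hL A] at h₅
  have h₆ := mul_le_mul_of_nonneg_right hts (sq_nonneg ‖R * V‖)
  rw [h₁, mul_pow]
  rw [h₂] at hσ
  nlinarith

omit [Fintype p] [DecidableEq q] in
theorem rank_le_rank_of_ker_le {p' : Type} {A : Matrix p q ℝ} {B : Matrix p' q ℝ} [Fintype p']
    (h : ∀ x, B *ᵥ x = 0 → A *ᵥ x = 0) : A.rank ≤ B.rank := by
  have h₁ := A.mulVecLin.finrank_range_add_finrank_ker
  have h₂ := B.mulVecLin.finrank_range_add_finrank_ker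
  have h₃ : Module.finrank ℝ B.mulVecLin.ker ≤ Module.finrank ℝ A.mulVecLin.ker :=
    Submodule.finrank_mono fun x hx => h x hx
  simp only [Matrix.rank]
  omega

omit [DecidableEq q] in
/-- A small perturbation of a well-conditioned matrix does not lose rank. -/
theorem rank_le_rank_add {p' : Type} [Fintype p'] {A : Matrix p' q ℝ} {M E : Matrix p q ℝ}
    {V : Matrix q q ℝ} (hVt : Vᵀ = V) (hV : V * V = V) (hAV : A * V = A) {t : ℝ}
    (ht : ∀ R : Matrix Unit q ℝ, t * ‖R * V‖ ≤ ‖R * Mᵀ‖) (hE : ‖E‖ < t) :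
    A.rank ≤ (M + E).rank := by
  refine (rank_le_rank_of_ker_le (B := (M + E) * V) fun x hx => ?_).trans
    (Matrix.rank_mul_le_left _ _)
  obtain ⟨y, hy⟩ : ∃ y, y = V *ᵥ x := ⟨_, rfl⟩
  have hVy : V *ᵥ y = y := by rw [hy, Matrix.mulVec_mulVec, hV]
  rw [← Matrix.mulVec_mulVec, ← hy] at hx
  obtain ⟨R, hR⟩ : ∃ R : Matrix Unit q ℝ, R = Matrix.replicateRow Unit y := ⟨_, rfl⟩
  have hRV : R * V = R := by
    rw [hR, ← Matrix.replicateRow_vecMul, ← Matrix.mulVec_transpose, hVt, hVy]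
  have hRN : R * (M + E)ᵀ = 0 := by
    rw [hR, ← Matrix.replicateRow_vecMul, Matrix.vecMul_transpose, hx, Matrix.replicateRow_zero]
  have h₁ : R * Mᵀ = -(R * Eᵀ) := by
    rw [Matrix.transpose_add, Matrix.mul_add] at hRN
    exact eq_neg_of_add_eq_zero_left hRN
  have h₂ := ht R
  rw [hRV, h₁, norm_neg] at h₂
  have h₃ := Matrix.frobenius_norm_mul R Eᵀ
  rw [Matrix.frobenius_norm_transpose] at h₃
  -- Here `t * ‖R‖ ≤ ‖R‖ * ‖E‖` while `‖E‖ < t`.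
  have h₄ : ‖R‖ = 0 := by nlinarith [norm_nonneg R]
  have h₅ : y = 0 := by
    rw [norm_eq_zero, hR, Matrix.replicateRow_eq_zero] at h₄
    exact h₄
  rw [← hAV, ← Matrix.mulVec_mulVec, ← hy, h₅, Matrix.mulVec_zero]

/-- Take `u_j = N w_j / σ_j` for right singular vectors `w_j`; the rank hypothesis makes the
divisors nonzero. -/
theorem exists_isTopLeftSingularVectors (N : Matrix p q ℝ) (h : s ≤ N.rank) :
    ∃ U : Matrix p (Fin s) ℝ, IsTopLeftSingularVectors N U := by
  obtain ⟨W, h₁, -, h₃⟩ := exists_rightSingularBasis N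
  have hs : s ≤ Fintype.card q := h.trans N.rank_le_card_width
  have hσ : ∀ j : Fin s, singVal N (j + 1) ≠ 0 := fun j =>
    ((singVal_succ_pos_iff N j).mpr (j.2.trans_le h)).ne'
  have hcol : ∀ j : Fin s, (Nᵀ * N) *ᵥ W.col (Fin.castLE hs j)
      = singVal N (j + 1) ^ 2 • W.col (Fin.castLE hs j) := by
    intro j
    ext i
    have := congrFun (congrFun h₃ i) (Fin.castLE hs j)
    rw [Matrix.mul_diagonal, mul_comm (W i _)] at this
    simpa [Matrix.mulVec, dotProduct, Matrix.mul_apply (M := Nᵀ * N)] using this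
  let U : Matrix p (Fin s) ℝ :=
    Matrix.of fun i j => (singVal N (j + 1))⁻¹ * (N *ᵥ W.col (Fin.castLE hs j)) i
  have hUcol : ∀ j, U.col j = (singVal N (j + 1))⁻¹ • N *ᵥ W.col (Fin.castLE hs j) := by
    intro j
    ext i
    simp [U]
  refine ⟨U, ?_, fun j => ?_⟩
  · ext i j
    have e : (Uᵀ * U) i j = U.col i ⬝ᵥ U.col j := by
      simp [Matrix.mul_apply, dotProduct]
    have o : W.col (Fin.castLE hs i) ⬝ᵥ W.col (Fin.castLE hs j)
        = (1 : Matrix (Fin s) (Fin s) ℝ) i j := by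
      have := congrFun (congrFun h₁ (Fin.castLE hs i)) (Fin.castLE hs j)
      simpa [Matrix.mul_apply, dotProduct, Matrix.one_apply] using this
    rw [e, hUcol, hUcol, smul_dotProduct, dotProduct_smul, Matrix.dotProduct_mulVec,
      ← Matrix.mulVec_transpose, Matrix.mulVec_mulVec, hcol, smul_dotProduct, o]
    rcases eq_or_ne i j with rfl | hij
    · have := hσ i
      simp only [Matrix.one_apply_eq, smul_eq_mul]
      field_simp
    · simp [Matrix.one_apply_ne hij]
  · rw [hUcol, Matrix.mulVec_smul, Matrix.mulVec_mulVec, Matrix.mul_assoc, ← Matrix.mulVec_mulVec,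
      hcol, Matrix.mulVec_smul, smul_comm]

end Perturbation

/-! ### Separations and Kronecker compression. -/

section Separations

variable {d : ℕ → ℕ} {m : ℕ}

theorem glue_bijective {k : ℕ} (hk : k ≤ m) :
    Function.Bijective fun z : Pre d k × Suf d m k => glue z.1 z.2 := by
  constructor
  · rintro ⟨x, y⟩ ⟨x', y'⟩ h
    refine Prod.ext (funext fun j => ?_) (funext fun j => ?_)
    · simpa [glue] using congrFun h ⟨j, j.2.trans_le hk⟩
    · simpa [glue, j.2.not_gt] using congrFun h j.1
  · intro z
    refine ⟨(fun j => z ⟨j, j.2.trans_le hk⟩, fun j => z j.1), ?_⟩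
    ext j
    simp only [glue]
    split_ifs <;> rfl

theorem fro_sq (T : Tensor d m) : fro T ^ 2 = ∑ x, T x ^ 2 :=
  Real.sq_sqrt (Finset.sum_nonneg fun _ _ => sq_nonneg _)

theorem fro_nonneg (T : Tensor d m) : 0 ≤ fro T := Real.sqrt_nonneg _

theorem norm_sep (T : Tensor d m) {k : ℕ} (hk : k ≤ m) : ‖sep T k‖ = fro T := by
  refine (sq_eq_sq₀ (norm_nonneg _) (fro_nonneg _)).mp ?_
  rw [norm_sq_eq_sum, fro_sq, ← Fintype.sum_prod_type']
  exact (glue_bijective hk).sum_comp fun x => T x ^ 2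

theorem fro_eq_zero {T : Tensor d m} (h : fro T = 0) : T = 0 := by
  rw [← norm_sep T le_rfl, norm_eq_zero] at h
  ext x
  obtain ⟨⟨y, z⟩, rfl⟩ := (glue_bijective (d := d) (le_refl m)).2 x
  exact congrFun (congrFun h y) z

theorem fro_smul (c : ℝ) (T : Tensor d m) : fro (c • T) = |c| * fro T := by
  rw [← norm_sep _ le_rfl, ← norm_sep T le_rfl, ← Real.norm_eq_abs, ← norm_smul]
  rfl

theorem sep_add (T T' : Tensor d m) (k : ℕ) : sep (T + T') k = sep T k + sep T' k := rfl

theorem sep_sub (T T' : Tensor d m) (k : ℕ) : sep (T - T') k = sep T k - sep T' k := rfl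

theorem smul_mem_ttSet {r : ℕ → ℕ} {T : Tensor d m} (hT : T ∈ ttSet d m r) (c : ℝ) :
    c • T ∈ ttSet d m r := by
  intro k h₁ h₂
  have h : sep (c • T) k = sep T k * (c • (1 : Matrix (Suf d m k) (Suf d m k) ℝ)) := by
    rw [Matrix.mul_smul, Matrix.mul_one]
    rfl
  rw [h]
  exact (Matrix.rank_mul_le_left _ _).trans (hT k h₁ h₂)

theorem sum_pre_succ {k : ℕ} (f : Pre d (k + 1) → ℝ) :
    ∑ x, f x = ∑ i : Fin (d k), ∑ x : Pre d k,
      f (Fin.snoc (α := fun j : Fin (k + 1) => Fin (d j)) x i) := by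
  rw [← (Fin.snocEquiv fun j : Fin (k + 1) => Fin (d j)).sum_comp f, Fintype.sum_prod_type]
  rfl

theorem kronId_snoc {k s : ℕ} (M : Matrix (Pre d k) (Fin s) ℝ) (x : Pre d k) (i : Fin (d k))
    (z : Fin s × Fin (d k)) :
    kronId M (Fin.snoc (α := fun j : Fin (k + 1) => Fin (d j)) x i) z
      = if i = z.2 then M x z.1 else 0 := by
  simp [kronId, Matrix.one_apply]

theorem kronId_transpose_mul_apply {k s : ℕ} {n : Type*} (M : Matrix (Pre d k) (Fin s) ℝ)
    (B : Matrix (Pre d (k + 1)) n ℝ) (z : Fin s × Fin (d k)) (y : n) :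
    ((kronId M)ᵀ * B) z y
      = ∑ x, M x z.1 * B (Fin.snoc (α := fun j : Fin (k + 1) => Fin (d j)) x z.2) y := by
  rw [Matrix.mul_apply, sum_pre_succ, Finset.sum_eq_single z.2]
  · simp [kronId_snoc]
  · intro i _ hi
    simp [kronId_snoc, hi]
  · simp

theorem kronId_transpose_mul_self {k s : ℕ} {M : Matrix (Pre d k) (Fin s) ℝ} (hM : Mᵀ * M = 1) :
    (kronId M)ᵀ * kronId M = 1 := by
  ext ⟨a, i⟩ ⟨b, j⟩
  have h := congrFun (congrFun hM a) b
  rw [Matrix.mul_apply] at h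
  rw [kronId_transpose_mul_apply]
  simp only [kronId_snoc]
  by_cases hij : i = j
  · simpa [hij, Matrix.one_apply] using h
  · simp [hij]

theorem suf_split_bijective {k : ℕ} (hk : k < m) :
    Function.Bijective fun z : Suf d m k =>
      ((z ⟨⟨k, hk⟩, le_rfl⟩ : Fin (d k)),
        ((fun j => z ⟨j.1, (Nat.le_succ k).trans j.2⟩) : Suf d m (k + 1))) := by
  constructor
  · intro z z' h
    ext ⟨⟨j, hj⟩, hkj⟩
    rcases eq_or_lt_of_le (show k ≤ j from hkj) with rfl | h'
    · exact congrArg Fin.val (congrArg Prod.fst h)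
    · exact congrArg Fin.val (congrFun (congrArg Prod.snd h) ⟨⟨j, hj⟩, h'⟩)
  · rintro ⟨i, y⟩
    refine ⟨fun j => if h : k = (j.1 : ℕ) then Fin.cast (congrArg d h) i
      else y ⟨j.1, lt_of_le_of_ne j.2 h⟩, Prod.ext (by simp) (funext fun j => ?_)⟩
    have h : k ≠ (j.1 : ℕ) := (Nat.lt_of_succ_le j.2).ne
    simp [h]

theorem glue_snoc {k : ℕ} (hk : k < m) (x : Pre d k) (z : Suf d m k) :
    glue (Fin.snoc (α := fun j : Fin (k + 1) => Fin (d j)) x (z ⟨⟨k, hk⟩, le_rfl⟩))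
      ((fun j => z ⟨j.1, (Nat.le_succ k).trans j.2⟩) : Suf d m (k + 1)) = glue x z := by
  ext ⟨j, hj⟩
  simp only [glue]
  rcases lt_trichotomy j k with h | rfl | h
  · simp [h, h.trans (Nat.lt_succ_self k), Fin.snoc]
  · simp [Fin.snoc]
  · simp [h.not_gt, show ¬ j < k + 1 by omega]

/-- Both matrices have the same entries, with the mode after `k` moved between columns and rows.
Passing to the next separation therefore loses no energy. -/
theorem norm_kronId_transpose_mul_sep {k s : ℕ} (hk : k < m) (M : Matrix (Pre d k) (Fin s) ℝ)
    (T : Tensor d m) : ‖(kronId M)ᵀ * sep T (k + 1)‖ = ‖Mᵀ * sep T k‖ := by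
  refine (sq_eq_sq₀ (norm_nonneg _) (norm_nonneg _)).mp ?_
  rw [norm_sq_eq_sum, norm_sq_eq_sum, Fintype.sum_prod_type]
  refine Finset.sum_congr rfl fun a _ => ?_
  rw [← Fintype.sum_prod_type', ← (suf_split_bijective hk).sum_comp]
  refine Finset.sum_congr rfl fun z _ => ?_
  rw [kronId_transpose_mul_apply, Matrix.mul_apply]
  simp only [sep, Matrix.of_apply, glue_snoc, Matrix.transpose_apply]

end Separations

/-! ### Orthonormality of the left parts. -/

section LeftParts

variable {d r : ℕ → ℕ}

theorem leftPart_succ (G : Components d r) (k : ℕ) :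
    leftPart G (k + 1) = kronId (leftPart G k) * leftUnfold (G k) := by
  ext x b
  rw [Matrix.mul_apply, Fintype.sum_prod_type]
  simp [leftPart, leftUnfold, kronId, Matrix.vecMul, dotProduct, Matrix.one_apply]

theorem leftPart_congr {G G' : Components d r} {k : ℕ} (h : ∀ j, j < k → G j = G' j) :
    leftPart G k = leftPart G' k := by
  induction k with
  | zero => rfl
  | succ k ih => rw [leftPart_succ, leftPart_succ, ih fun j hj => h j (by omega), h k (by omega)]

theorem leftPart_transpose_mul_self {G : Components d r} (hr : r 0 = 1) {k : ℕ}
    (h : ∀ j, j < k → (leftUnfold (G j))ᵀ * leftUnfold (G j) = 1) :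
    (leftPart G k)ᵀ * leftPart G k = 1 := by
  induction k with
  | zero =>
    have : Subsingleton (Fin (r 0)) := by rw [hr]; infer_instance
    ext a b
    rw [Subsingleton.elim b a]
    simp [leftPart, Matrix.mul_apply]
  | succ k ih =>
    rw [leftPart_succ, Matrix.transpose_mul, Matrix.mul_assoc, ← Matrix.mul_assoc (kronId _)ᵀ,
      kronId_transpose_mul_self (ih fun j hj => h j (by omega)), Matrix.one_mul, h k (by omega)]

theorem norm_leftPart_zero_transpose_mul_sep {m : ℕ} (hr : r 0 = 1) (G : Components d r)
    (T : Tensor d m) : ‖(leftPart G 0)ᵀ * sep T 0‖ = fro T := by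
  have h : leftPart G 0 * (leftPart G 0)ᵀ = 1 := by
    ext x y
    rw [Subsingleton.elim y x]
    simp [leftPart, Matrix.mul_apply, hr]
  rw [norm_mul_of_transpose_mul_self (by rwa [Matrix.transpose_transpose]),
    norm_sep T (Nat.zero_le m)]

end LeftParts

/-! ### Energy balance along a run of TT-SVD. -/

section Algorithm

variable {d r : ℕ → ℕ} {m : ℕ}

theorem sigmaMin_nonneg (T : Tensor d m) : 0 ≤ sigmaMin r T :=
  Real.iInf_nonneg fun _ => singVal_nonneg _ _

theorem sigmaMin_le (T : Tensor d m) {k : ℕ} (hk : k + 1 < m) :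
    sigmaMin r T ≤ singVal (sep T (k + 1)) (r (k + 1)) :=
  ciInf_le (f := fun i : Fin (m - 1) => singVal (sep T (i + 1)) (r (i + 1)))
    (Set.finite_range _).bddBelow ⟨k, by omega⟩

/-- The part of `‖T‖²` that is lost by the projection onto the range of the `k`-th left part. -/
def lostEnergy (G : Components d r) (T : Tensor d m) (k : ℕ) : ℝ :=
  fro T ^ 2 - ‖(leftPart G k)ᵀ * sep T k‖ ^ 2

/-- The first `n` steps of TT-SVD. -/
def IsPartialRun (G : Components d r) (T : Tensor d m) (n : ℕ) : Prop :=
  ∀ k, k < n →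
    IsTopLeftSingularVectors ((kronId (leftPart G k))ᵀ * sep T (k + 1)) (leftUnfold (G k))

theorem IsPartialRun.leftPart_transpose_mul_self {G : Components d r} {T : Tensor d m} {n : ℕ}
    (hr : r 0 = 1) (h : IsPartialRun G T n) : (leftPart G n)ᵀ * leftPart G n = 1 :=
  TensorTrain.leftPart_transpose_mul_self hr fun j hj => (h j hj).1

theorem norm_kronId_transpose_mul_sep_le {G : Components d r} (T : Tensor d m) {k : ℕ} (hk : k < m)
    (h : (leftPart G k)ᵀ * leftPart G k = 1) :
    ‖(kronId (leftPart G k))ᵀ * sep T (k + 1)‖ ≤ fro T := by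
  rw [← norm_sep T hk]
  exact norm_transpose_mul_le (kronId_transpose_mul_self h) _

theorem lostEnergy_succ {G : Components d r} (T : Tensor d m) {k : ℕ} (hk : k < m)
    (h : (leftUnfold (G k))ᵀ * leftUnfold (G k) = 1) :
    lostEnergy G T (k + 1) = lostEnergy G T k
      + ‖(kronId (leftPart G k))ᵀ * sep T (k + 1)
          - leftUnfold (G k) * ((leftUnfold (G k))ᵀ
            * ((kronId (leftPart G k))ᵀ * sep T (k + 1)))‖ ^ 2 := by
  rw [norm_sq_sub_mul_transpose_mul h, norm_kronId_transpose_mul_sep hk, lostEnergy, lostEnergy,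
    leftPart_succ, Matrix.transpose_mul, Matrix.mul_assoc]
  ring

/-- As long as little of `T` is lost, the compressed separations of `T` stay well-conditioned on
their row spaces. -/
theorem exists_projection_compressed {T : Tensor d m} (hT : T ∈ ttSet d m r)
    (hr : ∀ k, 1 ≤ k → k < m → 0 < r k) {G : Components d r} {k : ℕ} (hk : k + 1 < m)
    (hG : (leftPart G k)ᵀ * leftPart G k = 1)
    (hlost : lostEnergy G T k ≤ 3 / 4 * sigmaMin r T ^ 2) :
    ∃ V : Matrix (Suf d m (k + 1)) (Suf d m (k + 1)) ℝ, Vᵀ = V ∧ V * V = V ∧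
      V.trace ≤ r (k + 1) ∧ sep T (k + 1) * V = sep T (k + 1) ∧
      ∀ {l : Type} [Fintype l] (R : Matrix l (Suf d m (k + 1)) ℝ),
        sigmaMin r T / 2 * ‖R * V‖ ≤ ‖R * ((kronId (leftPart G k))ᵀ * sep T (k + 1))ᵀ‖ := by
  obtain ⟨V, hVt, hV, htr, hTV, hR⟩ := exists_rowProjection (sep T (k + 1))
    (hr (k + 1) (by omega) hk) (hT (k + 1) (by omega) hk)
  refine ⟨V, hVt, hV, htr, hTV, fun R => ?_⟩
  refine mul_norm_mul_projection_le (kronId_transpose_mul_self hG) hVt hTV R (hR R) ?_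
  have h := pow_le_pow_left₀ (sigmaMin_nonneg (r := r) T) (sigmaMin_le T hk) 2
  rw [norm_sep T hk.le, norm_kronId_transpose_mul_sep (by omega)]
  unfold lostEnergy at hlost
  linarith

/-- With `δ ≤ 4 ε² / σ`, the cross term `2 ε δ` is at most `8 ε³ / σ`, and `δ²` fits into one more
`ε³ / σ` because `δ ≤ ε / 8`. -/
theorem sq_le_sq_add_of_le_add {x y δ ε σ : ℝ} (hx : 0 ≤ x) (hδ : 0 ≤ δ)
    (hyε : y ≤ ε) (hδε : δ ≤ ε) (hσ : 1000 * ε ≤ σ) (hσδ : σ / 2 * δ ≤ 2 * ε ^ 2)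
    (hxy : x ≤ y + δ) : x ^ 2 ≤ y ^ 2 + 9 * (ε ^ 3 / σ) := by
  rcases (hδ.trans hδε).eq_or_lt with h | hε
  · have : δ = 0 := le_antisymm (hδε.trans h.symm.le) hδ
    subst this
    simp only [← h]
    simpa using pow_le_pow_left₀ hx hxy 2
  · have hσ₀ : 0 < σ := by linarith
    have h₁ : x ^ 2 ≤ (y + δ) ^ 2 := pow_le_pow_left₀ hx hxy 2
    have h₂ : 2 * ε * δ + δ ^ 2 ≤ 9 * (ε ^ 3 / σ) := by
      rw [← mul_div_assoc, le_div_iff₀ hσ₀]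
      have h₃ : δ ≤ ε / 8 := by nlinarith
      nlinarith [mul_nonneg hδ (sub_nonneg.mpr hσδ), mul_nonneg hε.le (sub_nonneg.mpr hσδ),
        mul_nonneg (sq_nonneg ε) (sub_nonneg.mpr h₃)]
    nlinarith

/-- During TT-SVD, the signal loses at most what the noise loses, up to a third-order term. -/
theorem IsPartialRun.lostEnergy_le {T D : Tensor d m} (hm : 2 ≤ m) (hT : T ∈ ttSet d m r)
    (hr₀ : r 0 = 1) (hr : ∀ k, 1 ≤ k → k < m → 0 < r k)
    (hσ : 500 * m * fro D ≤ sigmaMin r T) {G : Components d r} {k : ℕ} (hk : k < m)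
    (hG : IsPartialRun G (T + D) k) :
    lostEnergy G T k ≤ lostEnergy G D k + 9 * k * (fro D ^ 3 / sigmaMin r T) ∧
      lostEnergy G T k ≤ 3 / 4 * sigmaMin r T ^ 2 := by
  have hε := fro_nonneg D
  have hm' : (2 : ℝ) ≤ m := by exact_mod_cast hm
  have hσ' : 1000 * fro D ≤ sigmaMin r T := by nlinarith
  -- The sharp bound implies the crude one, since it gives `lostEnergy G T n ≤ 10 * fro D ^ 2`. The
  -- crude bound leaves `σ² / 4` of the conditioning, which is what the next induction step needs.
  have key : ∀ n : ℕ, n < m →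
      lostEnergy G T n ≤ lostEnergy G D n + 9 * n * (fro D ^ 3 / sigmaMin r T) →
      lostEnergy G T n ≤ 3 / 4 * sigmaMin r T ^ 2 := by
    intro n hn h
    have h₁ : lostEnergy G D n ≤ fro D ^ 2 := sub_le_self _ (sq_nonneg _)
    have h₂ : n * (fro D ^ 3 / sigmaMin r T) ≤ fro D ^ 2 := by
      rcases (sigmaMin_nonneg (r := r) T).eq_or_lt with h₀ | h₀
      · rw [← h₀]
        simpa using sq_nonneg (fro D)
      · rw [← mul_div_assoc, div_le_iff₀ h₀]
        have hnm : (n : ℝ) ≤ m := by exact_mod_cast hn.le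
        have : n * fro D ≤ sigmaMin r T := by nlinarith
        nlinarith [sq_nonneg (fro D)]
    nlinarith
  suffices h : lostEnergy G T k ≤ lostEnergy G D k + 9 * k * (fro D ^ 3 / sigmaMin r T) from
    ⟨h, key k hk h⟩
  induction k with
  | zero =>
    simp only [lostEnergy, norm_leftPart_zero_transpose_mul_sep hr₀]
    simp
  | succ k ih =>
    have hG' : IsPartialRun G (T + D) k := fun j hj => hG j (by omega)
    have ih := ih (by omega) hG'
    have hX := hG'.leftPart_transpose_mul_self hr₀
    have hU := hG k (by omega)
    obtain ⟨V, hVt, hV, htr, hTV, hR⟩ :=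
      exists_projection_compressed hT hr hk hX (key k (by omega) ih)
    have hM : (kronId (leftPart G k))ᵀ * sep T (k + 1) * V
        = (kronId (leftPart G k))ᵀ * sep T (k + 1) := by rw [Matrix.mul_assoc, hTV]
    have hE := norm_kronId_transpose_mul_sep_le (G := G) D (show k < m by omega) hX
    have hU' := hU
    rw [sep_add, Matrix.mul_add] at hU'
    obtain ⟨δ, hδ₀, hδ₁, hδ₂, hδ₃⟩ := hU'.norm_sub_le_norm_sub_add hVt hV htr hM (fun R => hR R) hE
    have hy : ‖(kronId (leftPart G k))ᵀ * sep D (k + 1)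
        - leftUnfold (G k) * ((leftUnfold (G k))ᵀ
          * ((kronId (leftPart G k))ᵀ * sep D (k + 1)))‖ ≤ fro D := by
      refine le_trans (le_of_sq_le_sq ?_ (norm_nonneg _)) hE
      rw [norm_sq_sub_mul_transpose_mul hU.1]
      exact sub_le_self _ (sq_nonneg _)
    have h := sq_le_sq_add_of_le_add (norm_nonneg _) hδ₀ hy hδ₁ hσ' hδ₂ hδ₃
    rw [lostEnergy_succ T (by omega) hU.1, lostEnergy_succ D (by omega) hU.1]
    push_cast
    linarith

theorem sep_ofComponents {n : ℕ} (hr : r (n + 1) = 1) {G : Components d r} {T : Tensor d (n + 1)}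
    (h : ∀ (y : Suf d (n + 1) n) (a : Fin (r n)) (b : Fin (r (n + 1))),
      G n (y ⟨⟨n, by omega⟩, le_rfl⟩) a b = ((leftPart G n)ᵀ * sep T n) a y) :
    sep (ofComponents (n + 1) G) n = leftPart G n * ((leftPart G n)ᵀ * sep T n) := by
  ext x y
  have e : ∀ b, leftPart G (n + 1) (glue x y) b
      = (leftPart G n * ((leftPart G n)ᵀ * sep T n)) x y := by
    intro b
    have hx : (fun j : Fin n => (glue x y : Pre d (n + 1)) j.castSucc) = x := by
      ext j
      simp [glue]
    have hy : (glue x y : Pre d (n + 1)) (Fin.last n) = y ⟨⟨n, by omega⟩, le_rfl⟩ := by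
      simp [glue, Fin.last]
    simp only [leftPart, Matrix.of_apply, Matrix.vecMul, dotProduct]
    rw [Matrix.mul_apply, hx]
    refine Finset.sum_congr rfl fun a _ => ?_
    rw [← h y a b]
    exact congrArg (fun i => leftPart G n x a * G n i a b) hy
  have : sep (ofComponents (n + 1) G) n x y = ∑ b, leftPart G (n + 1) (glue x y) b := rfl
  rw [this, Finset.sum_congr rfl fun b _ => e b]
  simp [hr]

/-- The error splits orthogonally into `X Xᵀ D`, inside the range of `X`, and the lost part of `A`,
outside it. -/
theorem norm_sq_mul_sub {p l q : Type*} [Fintype p] [Fintype l] [Fintype q] [DecidableEq l]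
    {X : Matrix p l ℝ} (hX : Xᵀ * X = 1) (A D : Matrix p q ℝ) :
    ‖X * (Xᵀ * (A + D)) - A‖ ^ 2 = ‖Xᵀ * D‖ ^ 2 + (‖A‖ ^ 2 - ‖Xᵀ * A‖ ^ 2) := by
  have h := norm_sq_sub_mul_transpose_mul hX (X * (Xᵀ * (A + D)) - A)
  have h₁ : Xᵀ * (X * (Xᵀ * (A + D)) - A) = Xᵀ * D := by
    rw [Matrix.mul_sub, ← Matrix.mul_assoc, hX, Matrix.one_mul, Matrix.mul_add, add_sub_cancel_left]
  have h₂ : X * (Xᵀ * (A + D)) - A - X * (Xᵀ * D) = -(A - X * (Xᵀ * A)) := by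
    rw [Matrix.mul_add, Matrix.mul_add]
    abel
  rw [h₁, h₂, norm_neg, norm_sq_sub_mul_transpose_mul hX] at h
  linarith

/-- The perturbation bound for TT-SVD. -/
theorem IsTTSVD.fro_sub_sq_le {T D S : Tensor d m} (hm : 2 ≤ m) (hT : T ∈ ttSet d m r)
    (hr₀ : r 0 = 1) (hr_last : r m = 1) (hr : ∀ k, 1 ≤ k → k < m → 0 < r k)
    (hσ : 500 * m * fro D ≤ sigmaMin r T) (hS : IsTTSVD r (T + D) S) :
    fro (S - T) ^ 2 ≤ fro D ^ 2 + 9 * m * (fro D ^ 3 / sigmaMin r T) := by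
  obtain ⟨n, rfl⟩ : ∃ n, m = n + 1 := ⟨m - 1, by omega⟩
  obtain ⟨G, hG, hlast, rfl⟩ := hS
  have hrun : IsPartialRun G (T + D) n := fun k hk => hG k (by omega)
  have hX := hrun.leftPart_transpose_mul_self hr₀
  have h := (hrun.lostEnergy_le hm hT hr₀ hr hσ (by omega)).1
  have h₁ : fro (ofComponents (n + 1) G - T) ^ 2
      = fro D ^ 2 - lostEnergy G D n + lostEnergy G T n := by
    rw [← norm_sep _ (Nat.le_succ n), sep_sub, sep_ofComponents hr_last (hlast n rfl), sep_add,
      norm_sq_mul_sub hX, lostEnergy, lostEnergy, norm_sep T (Nat.le_succ n)]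
    ring
  have h₂ : (0 : ℝ) ≤ fro D ^ 3 / sigmaMin r T :=
    div_nonneg (pow_nonneg (fro_nonneg D) 3) (sigmaMin_nonneg T)
  rw [h₁]
  push_cast
  linarith

/-! ### Existence of a run. -/

theorem IsPartialRun.congr {G G' : Components d r} {T : Tensor d m} {n : ℕ}
    (hG : IsPartialRun G T n) (h : ∀ j, j < n → G j = G' j) : IsPartialRun G' T n := by
  intro k hk
  rw [← leftPart_congr fun j hj => h j (hj.trans hk), ← h k hk]
  exact hG k hk

theorem exists_isPartialRun {T D : Tensor d m} (hm : 2 ≤ m) (hT : T ∈ ttSet d m r)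
    (hr₀ : r 0 = 1) (hr : ∀ k, 1 ≤ k → k < m → 0 < r k)
    (hσ : 500 * m * fro D ≤ sigmaMin r T) (hσ₀ : 0 < sigmaMin r T) {n : ℕ} (hn : n < m) :
    ∃ G : Components d r, IsPartialRun G (T + D) n := by
  induction n with
  | zero => exact ⟨fun _ _ => 0, fun k hk => absurd hk (Nat.not_lt_zero k)⟩
  | succ n ih =>
    obtain ⟨G, hG⟩ := ih (by omega)
    have hX := hG.leftPart_transpose_mul_self hr₀
    obtain ⟨V, hVt, hV, -, hTV, hR⟩ := exists_projection_compressed hT hr hn hX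
      (hG.lostEnergy_le hm hT hr₀ hr hσ (by omega)).2
    have hE := norm_kronId_transpose_mul_sep_le (G := G) D (show n < m by omega) hX
    have hm' : (2 : ℝ) ≤ m := by exact_mod_cast hm
    have hE' : ‖(kronId (leftPart G n))ᵀ * sep D (n + 1)‖ < sigmaMin r T / 2 := by
      nlinarith [fro_nonneg D]
    -- The compressed noisy matrix keeps the rank of the full separation of `T`, which is at least
    -- `r (n + 1)` because that singular value is positive.
    have hrank := rank_le_rank_add hVt hV hTV (fun R => hR R) hE'
    rw [← Matrix.mul_add, ← sep_add] at hrank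
    have hrn := hr (n + 1) (by omega) hn
    have hrank' : r (n + 1) ≤ (sep T (n + 1)).rank := by
      have h := hσ₀.trans_le (sigmaMin_le T hn)
      rw [← Nat.sub_add_cancel hrn, singVal_succ_pos_iff] at h
      omega
    obtain ⟨U, hU⟩ := exists_isTopLeftSingularVectors _ (hrank'.trans hrank)
    let G' : Components d r := Function.update G n fun x => Matrix.of fun a b => U (a, x) b
    have hGG' : ∀ j, j < n → G j = G' j := fun j hj => (Function.update_of_ne hj.ne _ _).symm
    refine ⟨G', fun k hk => ?_⟩
    rcases Nat.lt_succ_iff_lt_or_eq.mp hk with hk | rfl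
    · exact hG.congr hGG' k hk
    · have h : leftUnfold (G' k) = U := by
        ext ⟨a, x⟩ b
        simp [leftUnfold, G']
      rwa [h, ← leftPart_congr hGG']

theorem exists_isTTSVD {T D : Tensor d m} (hm : 2 ≤ m) (hT : T ∈ ttSet d m r)
    (hr₀ : r 0 = 1) (hr : ∀ k, 1 ≤ k → k < m → 0 < r k)
    (hσ : 500 * m * fro D ≤ sigmaMin r T) (hσ₀ : 0 < sigmaMin r T) :
    ∃ S, IsTTSVD r (T + D) S := by
  obtain ⟨n, rfl⟩ : ∃ n, m = n + 1 := ⟨m - 1, by omega⟩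
  obtain ⟨G, hG⟩ := exists_isPartialRun hm hT hr₀ hr hσ hσ₀ (Nat.lt_succ_self n)
  -- A suffix starting at the last mode has a single index, so it is determined by one entry.
  let suf : Fin (d n) → Suf d (n + 1) n := fun x j =>
    Fin.cast (congrArg d (by have := j.2; have := j.1.2; omega)) x
  have hsuf : ∀ y : Suf d (n + 1) n, suf (y ⟨⟨n, by omega⟩, le_rfl⟩) = y := by
    intro y
    ext ⟨⟨j, hj⟩, hnj⟩
    obtain rfl : j = n := le_antisymm (Nat.lt_succ_iff.mp hj) hnj
    rfl
  let G' : Components d r := Function.update G n fun x =>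
    Matrix.of fun a _ => ((leftPart G n)ᵀ * sep (T + D) n) a (suf x)
  have hGG' : ∀ j, j < n → G j = G' j := fun j hj => (Function.update_of_ne hj.ne _ _).symm
  refine ⟨_, G', fun k hk => hG.congr hGG' k (by omega), fun k hk y a b => ?_, rfl⟩
  obtain rfl : k = n := by omega
  rw [← leftPart_congr hGG']
  simp [G', hsuf]

/-! ### Exact recovery and sharpness. -/

/-- TT-SVD reproduces tensors of TT rank at most `r`. -/
theorem IsTTSVD.eq_of_mem_ttSet {T S : Tensor d m} (hm : 2 ≤ m) (hT : T ∈ ttSet d m r)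
    (hr₀ : r 0 = 1) (hr_last : r m = 1) (hr : ∀ k, 1 ≤ k → k < m → 0 < r k)
    (hS : IsTTSVD r T S) : S = T := by
  have h₀ : fro (0 : Tensor d m) = 0 := by simp [fro]
  -- With zero noise the bound is `0`, even if `sigmaMin r T = 0`, since then `0 / 0 = 0`.
  have h := IsTTSVD.fro_sub_sq_le (D := 0) hm hT hr₀ hr_last hr
    (by simpa [h₀] using sigmaMin_nonneg T) (by rwa [add_zero])
  rw [h₀] at h
  have h' : fro (S - T) = 0 := by simpa using h
  exact sub_eq_zero.mp (fro_eq_zero h')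

theorem fro_pos_of_sigmaMin_pos {T : Tensor d m} (hm : 2 ≤ m) (hr : ∀ k, 1 ≤ k → k < m → 0 < r k)
    (h : 0 < sigmaMin r T) : 0 < fro T := by
  refine (fro_nonneg T).lt_of_ne fun h₀ => ?_
  have h₁ := h.trans_le (sigmaMin_le T (show 0 + 1 < m by omega))
  rw [← Nat.sub_add_cancel (hr (0 + 1) (by omega) (by omega)), singVal_succ_pos_iff,
    fro_eq_zero h₀.symm] at h₁
  have h₂ : sep (0 : Tensor d m) (0 + 1) = 0 := rfl
  rw [h₂, Matrix.rank_zero] at h₁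
  exact absurd h₁ (Nat.not_lt_zero _)

end Algorithm

end TensorTrain

end

theorem mainTheorem4 (m : ℕ) (hm : 2 ≤ m) (d r : ℕ → ℕ)
    (hr_zero : r 0 = 1) (hr_last : r m = 1) (hr_pos : ∀ k, 1 ≤ k → k < m → 0 < r k)
    (Tstar : TensorTrain.Tensor d m) (hT : Tstar ∈ TensorTrain.ttSet d m r)
    (C : ℝ) (hC : 500 * (m : ℝ) ≤ C) :
    -- the perturbation bound, for every run of the algorithm (and the algorithm does run)
    (∀ D : TensorTrain.Tensor d m,
      C * TensorTrain.fro D ≤ TensorTrain.sigmaMin r Tstar →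
        (0 < TensorTrain.sigmaMin r Tstar →
          ∃ S : TensorTrain.Tensor d m, TensorTrain.IsTTSVD r (Tstar + D) S) ∧
        ∀ S : TensorTrain.Tensor d m, TensorTrain.IsTTSVD r (Tstar + D) S →
          TensorTrain.fro (S - Tstar) ^ 2 ≤
            TensorTrain.fro D ^ 2
              + 600 * (m : ℝ) * TensorTrain.fro D ^ 3 / TensorTrain.sigmaMin r Tstar) ∧
    -- the leading constant 1 cannot be lowered
    (0 < TensorTrain.sigmaMin r Tstar → ∀ c : ℝ, c < 1 → ∀ K : ℝ,
      ∃ D : TensorTrain.Tensor d m, D ≠ 0 ∧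
        C * TensorTrain.fro D ≤ TensorTrain.sigmaMin r Tstar ∧
        ∀ S : TensorTrain.Tensor d m, TensorTrain.IsTTSVD r (Tstar + D) S →
          c * TensorTrain.fro D ^ 2
              + K * TensorTrain.fro D ^ 3 / TensorTrain.sigmaMin r Tstar
            < TensorTrain.fro (S - Tstar) ^ 2) := by
  constructor
  · intro D hD
    have hσ : 500 * m * TensorTrain.fro D ≤ TensorTrain.sigmaMin r Tstar :=
      (mul_le_mul_of_nonneg_right hC (TensorTrain.fro_nonneg D)).trans hD
    refine ⟨TensorTrain.exists_isTTSVD hm hT hr_zero hr_pos hσ, fun S hS => ?_⟩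
    refine (hS.fro_sub_sq_le hm hT hr_zero hr_last hr_pos hσ).trans ?_
    have h₀ : (0 : ℝ) ≤ TensorTrain.fro D ^ 3 / TensorTrain.sigmaMin r Tstar :=
      div_nonneg (pow_nonneg (TensorTrain.fro_nonneg D) 3) (TensorTrain.sigmaMin_nonneg Tstar)
    rw [mul_div_assoc (600 * (m : ℝ))]
    gcongr
    norm_num
  · intro hσ c hc K
    have hT₀ := TensorTrain.fro_pos_of_sigmaMin_pos hm hr_pos hσ
    have hC₀ : 0 ≤ C := le_trans (by positivity) hC
    -- The denominator `C + |K| + 1` serves both constraints at once; the summand 1 keeps it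
    -- positive and makes the second one strict.
    obtain ⟨ε, hε, hε₁, hε₂⟩ : ∃ ε : ℝ, 0 < ε ∧ C * ε ≤ TensorTrain.sigmaMin r Tstar ∧
        K * ε < (1 - c) * TensorTrain.sigmaMin r Tstar := by
      have hmin : 0 < min 1 (1 - c) := lt_min one_pos (sub_pos.mpr hc)
      have hA : 0 < C + |K| + 1 := by positivity
      have hε : 0 < min 1 (1 - c) * TensorTrain.sigmaMin r Tstar / (C + |K| + 1) := by positivity
      have e : (C + |K| + 1) * (min 1 (1 - c) * TensorTrain.sigmaMin r Tstar / (C + |K| + 1))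
          = min 1 (1 - c) * TensorTrain.sigmaMin r Tstar := by field_simp
      have h₁ := mul_le_mul_of_nonneg_right (min_le_left 1 (1 - c)) hσ.le
      have h₂ := mul_le_mul_of_nonneg_right (min_le_right 1 (1 - c)) hσ.le
      have h₃ := mul_le_mul_of_nonneg_right (le_abs_self K) hε.le
      have h₄ := mul_nonneg hC₀ hε.le
      have h₅ := mul_nonneg (abs_nonneg K) hε.le
      exact ⟨_, hε, by linarith, by linarith⟩
    have hfro : TensorTrain.fro ((ε / TensorTrain.fro Tstar) • Tstar) = ε := by
      rw [TensorTrain.fro_smul, abs_of_pos (by positivity)]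
      field_simp
    refine ⟨(ε / TensorTrain.fro Tstar) • Tstar, fun h => ?_, by rwa [hfro], fun S hS => ?_⟩
    · rw [h] at hfro
      exact hε.ne (by simpa [TensorTrain.fro] using hfro)
    -- The perturbed tensor is a multiple of `Tstar`, so exact recovery applies.
    · have hmem : Tstar + (ε / TensorTrain.fro Tstar) • Tstar ∈ TensorTrain.ttSet d m r := by
        have h := TensorTrain.smul_mem_ttSet hT (1 + ε / TensorTrain.fro Tstar)
        rwa [add_smul, one_smul] at h
      rw [hS.eq_of_mem_ttSet hm hmem hr_zero hr_last hr_pos, add_sub_cancel_left, hfro]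
      have h₁ : K * ε ^ 3 / TensorTrain.sigmaMin r Tstar
          = K * ε / TensorTrain.sigmaMin r Tstar * ε ^ 2 := by ring
      have h₂ : K * ε / TensorTrain.sigmaMin r Tstar < 1 - c := (div_lt_iff₀ hσ).mpr hε₂
      rw [h₁]
      nlinarith [mul_lt_mul_of_pos_right h₂ (pow_pos hε 2)]
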